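/- There is an absolute constant $D>0$ with the following property. Let $2\le q<\infty$, let $s\ge 0$, $m\ge 0$ and $n\ge 2$ be integers, let $u\ge 1$ and $F\in\mathbb{R}$, and let $A\in\mathbb{R}^{m\times n}$ be a random matrix whose rows are independent (not necessarily identically distributed), isotropic, sub-Gaussian random vectors in $\mathbb{R}^n$, each with sub-Gaussian norm at most $F$. Here a random vector $x$ in $\mathbb{R}^n$ is isotropic if $\mathbb{E}[xx^{T}]=I_n$; it is sub-Gaussian if $\|\langle g,x\rangle\|_{\psi_2}<\infty$ for every $g\in\mathbb{R}^n$, where $\|X\|_{\psi_2}:=\inf\{t>0:\mathbb{E}\exp(X^2/t^2)\le 2\}$ for a real random variable $X$; and its sub-Gaussian norm is $\sup_{\|g\|_2=1}\|\langle g,x\rangle\|_{\psi_2}$. Suppose that $$m> D\,F^4u^2s^{2-2/q}\log(2n).$$ Then, with probability at least $1-2e^{-u^2}$, $$\inf_{h\in\ker(A)\setminus\{0\}}\frac{\|h\|_1}{\|h\|_q}>3\,s^{1-1/q},\qquad(*)$$ where the infimum over the empty set is $+\infty$. Moreover, whenever $(*)$ holds, $\ell_1/\ell_q$ minimization exactly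 recovers all nonzero $s$-sparse vectors: every $x_0\in\mathbb{R}^n\setminus\{0\}$ with at most $s$ nonzero entries is the unique global minimizer of $\|x\|_1/\|x\|_q$ over all $x\in\mathbb{R}^n\setminus\{0\}$ with $Ax=Ax_0$. -/

import Mathlib

open MeasureTheory ProbabilityTheory
open scoped ENNReal Matrix

namespace RatioRecovery

/-- The `ℓ_p` norm `(∑ i, |x i| ^ p) ^ (1 / p)` of a vector of `ℝⁿ`, for a real `0 < p < ∞`. -/
noncomputable def ellNorm {n : ℕ} (p : ℝ) (x : Fin n → ℝ) : ℝ :=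
  (∑ i, |x i| ^ p) ^ (1 / p)

/-- The sub-Gaussian Orlicz norm `inf {t > 0 : 𝔼 exp (X² / t²) ≤ 2}` of a real random variable.
The expectation is an integral of a nonnegative function with values in `[0, ∞]`, and the
infimum is taken in `[0, ∞]`, so that it is `∞` if there is no admissible `t`. -/
noncomputable def psi2Norm {Ω : Type*} [MeasurableSpace Ω] (X : Ω → ℝ) (μ : Measure Ω) : ℝ≥0∞ :=
  ⨅ (t : ℝ) (_ : 0 < t) (_ : ∫⁻ ω, ENNReal.ofReal (Real.exp (|X ω| ^ 2 / t ^ 2)) ∂μ ≤ 2),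
    ENNReal.ofReal t

/-- A random vector is sub-Gaussian if all its linear functionals have a finite Orlicz norm. -/
def IsSubGaussian {Ω : Type*} [MeasurableSpace Ω] {n : ℕ} (X : Ω → Fin n → ℝ) (μ : Measure Ω) :
    Prop :=
  ∀ g : Fin n → ℝ, psi2Norm (fun ω => g ⬝ᵥ X ω) μ < ∞

/-- The sub-Gaussian norm of a random vector: the supremum of the Orlicz norms of its
one-dimensional marginals in the directions of the Euclidean unit sphere. -/
noncomputable def vecPsi2Norm {Ω : Type*} [MeasurableSpace Ω] {n : ℕ} (X : Ω → Fin n → ℝ)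
    (μ : Measure Ω) : ℝ≥0∞ :=
  ⨆ (g : Fin n → ℝ) (_ : ellNorm 2 g = 1), psi2Norm (fun ω => g ⬝ᵥ X ω) μ

/-- A random vector is isotropic if `𝔼[X Xᵀ] = I`. (For measurable `X` the diagonal equations
force the entries to be square integrable, a non-integrable function having integral `0`.) -/
def IsIsotropic {Ω : Type*} [MeasurableSpace Ω] {n : ℕ} (X : Ω → Fin n → ℝ) (μ : Measure Ω) :
    Prop :=
  ∀ i j, ∫ ω, X ω i * X ω j ∂μ = (1 : Matrix (Fin n) (Fin n) ℝ) i j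

/-- The null-space ratio condition `inf {‖h‖₁ / ‖h‖_q : h ∈ ker A, h ≠ 0} > 3 s ^ (1 - 1 / q)`.
The infimum is taken in the extended reals, so that it is `+∞` if the kernel is trivial. -/
def NullSpaceRatio {m n : ℕ} (q : ℝ) (s : ℕ) (A : Matrix (Fin m) (Fin n) ℝ) : Prop :=
  ((3 * (s : ℝ) ^ (1 - 1 / q) : ℝ) : EReal) <
    ⨅ (h : Fin n → ℝ) (_ : A *ᵥ h = 0) (_ : h ≠ 0),
      ((ellNorm 1 h / ellNorm q h : ℝ) : EReal)

/-- A vector is `s`-sparse if it has at most `s` nonzero entries. -/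
def IsSparse {n : ℕ} (s : ℕ) (x : Fin n → ℝ) : Prop :=
  (Function.support x).ncard ≤ s

/-- `x₀` is the unique global minimizer of `‖x‖₁ / ‖x‖_q` over all `x ≠ 0` with `A x = b`. -/
def IsUniqueMinimizer {m n : ℕ} (q : ℝ) (A : Matrix (Fin m) (Fin n) ℝ) (b : Fin m → ℝ)
    (x₀ : Fin n → ℝ) : Prop :=
  (x₀ ≠ 0 ∧ A *ᵥ x₀ = b) ∧
    ∀ x : Fin n → ℝ, x ≠ 0 → A *ᵥ x = b → x ≠ x₀ →
      ellNorm 1 x₀ / ellNorm q x₀ < ellNorm 1 x / ellNorm q x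

/-- Uniform exact recovery: every nonzero `s`-sparse vector `x₀` is the unique global minimizer
of the `ℓ₁/ℓ_q` problem with data `b = A x₀`. -/
def ExactRecovery {m n : ℕ} (q : ℝ) (s : ℕ) (A : Matrix (Fin m) (Fin n) ℝ) : Prop :=
  ∀ x₀ : Fin n → ℝ, x₀ ≠ 0 → IsSparse s x₀ → IsUniqueMinimizer q A (A *ᵥ x₀) x₀

end RatioRecovery

/-! For `q ≥ 2` the `ℓ_q` norm is at most the `ℓ₂` norm, so it suffices to bound `‖h‖₁/‖h‖₂` below
on the kernel. This is done by Maurey's method. For `h ≠ 0`, `h/‖h‖₁` is a convex combination of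
signed basis vectors. Consider the indefinite form `B x x = ‖Ax‖² - (m/2)‖x‖²`, which is negative at
a nonzero kernel vector when `m > 0`. Greedy averaging (`exists_sum_bilin_le`) produces a sum of `k`
signed basis vectors whose `B`-value is controlled by that at `k h/‖h‖₁`, plus an error linear in
`k`. If `B` is nonnegative on all such sums and the columns of `A` are bounded, then `(k - 1)‖h‖₂² ≤
3‖h‖₁²` (`ellNorm_one_lower_of_signedSum`).

Only `(2n)^k + n` fixed vectors must be controlled, so Chernoff bounds for sums of sub-Gaussian
squares (`measureReal_sum_sq_tails`) and a union bound suffice, with `k` of order `s^(2-2/q)`.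
Recovery from the ratio condition is deterministic (`NullSpaceRatio.exactRecovery`). -/

namespace RatioRecovery

/-! ### Elementary `ℓ_p` inequalities. -/

section Norms

variable {n : ℕ}

lemma ellNorm_nonneg (p : ℝ) (x : Fin n → ℝ) : 0 ≤ ellNorm p x := by
  unfold ellNorm; positivity

lemma ellNorm_one (x : Fin n → ℝ) : ellNorm 1 x = ∑ i, |x i| := by
  simp [ellNorm]

lemma ellNorm_rpow {p : ℝ} (hp : 0 < p) (x : Fin n → ℝ) :
    ellNorm p x ^ p = ∑ i, |x i| ^ p := by
  unfold ellNorm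
  rw [← Real.rpow_mul (by positivity), one_div_mul_cancel hp.ne', Real.rpow_one]

lemma ellNorm_two_sq (x : Fin n → ℝ) : ellNorm 2 x ^ 2 = x ⬝ᵥ x := by
  have := ellNorm_rpow (p := 2) two_pos x
  simpa [dotProduct, ← sq] using this

lemma abs_le_ellNorm {p : ℝ} (hp : 0 < p) (x : Fin n → ℝ) (i : Fin n) :
    |x i| ≤ ellNorm p x := by
  rw [← Real.rpow_le_rpow_iff (abs_nonneg _) (ellNorm_nonneg _ _) hp, ellNorm_rpow hp]
  exact Finset.single_le_sum (f := fun i => |x i| ^ p) (fun _ _ => by positivity)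
    (Finset.mem_univ i)

lemma ellNorm_pos {p : ℝ} (hp : 0 < p) {x : Fin n → ℝ} (hx : x ≠ 0) : 0 < ellNorm p x := by
  obtain ⟨i, hi⟩ := Function.ne_iff.mp hx
  exact (abs_pos.mpr hi).trans_le (abs_le_ellNorm hp x i)

lemma ellNorm_antitone {p q : ℝ} (hp : 0 < p) (hpq : p ≤ q) (x : Fin n → ℝ) :
    ellNorm q x ≤ ellNorm p x := by
  have hq : 0 < q := hp.trans_le hpq
  rcases eq_or_ne x 0 with rfl | hx
  · simp [ellNorm, Real.zero_rpow, hp.ne', hq.ne']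
  have hN := ellNorm_pos hp hx
  rw [← Real.rpow_le_rpow_iff (ellNorm_nonneg _ _) (ellNorm_nonneg _ _) hq, ellNorm_rpow hq]
  have key : ∀ i, |x i| ^ q ≤ |x i| ^ p * ellNorm p x ^ (q - p) := by
    intro i
    rcases eq_or_lt_of_le (abs_nonneg (x i)) with h0 | h0
    · rw [← h0, Real.zero_rpow hq.ne', Real.zero_rpow hp.ne', zero_mul]
    · calc |x i| ^ q = |x i| ^ p * |x i| ^ (q - p) := by
            rw [← Real.rpow_add h0]; ring_nf
        _ ≤ _ := by
            gcongr
            exact abs_le_ellNorm hp x i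
  calc ∑ i, |x i| ^ q ≤ ∑ i, |x i| ^ p * ellNorm p x ^ (q - p) :=
        Finset.sum_le_sum fun i _ => key i
    _ = ellNorm p x ^ q := by
        rw [← Finset.sum_mul, ← ellNorm_rpow hp, ← Real.rpow_add hN]; ring_nf

lemma ellNorm_add_le {p : ℝ} (hp : 1 ≤ p) (x y : Fin n → ℝ) :
    ellNorm p (x + y) ≤ ellNorm p x + ellNorm p y :=
  Real.Lp_add_le Finset.univ x y hp

lemma sum_abs_le_card_rpow_mul_ellNorm {p : ℝ} (hp : 1 ≤ p) (T : Finset (Fin n))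
    (x : Fin n → ℝ) : ∑ i ∈ T, |x i| ≤ (T.card : ℝ) ^ (1 - 1 / p) * ellNorm p x := by
  have hp0 : 0 < p := by linarith
  have hN := ellNorm_nonneg p x
  rw [← Real.rpow_le_rpow_iff (by positivity) (by positivity) hp0,
    Real.mul_rpow (by positivity) hN, ellNorm_rpow hp0, ← Real.rpow_mul (by positivity)]
  have e : (1 - 1 / p) * p = p - 1 := by field_simp
  rw [e]
  refine (Real.rpow_sum_le_const_mul_sum_rpow T x hp).trans ?_
  gcongr
  exact T.subset_univ

end Norms

/-! ### From the null-space ratio to exact recovery. -/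

section Recovery

variable {m n : ℕ}

lemma NullSpaceRatio.lt {q : ℝ} (hq : 1 ≤ q) {s : ℕ} {A : Matrix (Fin m) (Fin n) ℝ}
    (hA : NullSpaceRatio q s A) {h : Fin n → ℝ} (hh : A *ᵥ h = 0) (h0 : h ≠ 0) :
    3 * (s : ℝ) ^ (1 - 1 / q) * ellNorm q h < ellNorm 1 h := by
  have h1 := hA.trans_le (iInf_le_of_le h (iInf_le_of_le hh (iInf_le _ h0)))
  rw [EReal.coe_lt_coe_iff] at h1
  rwa [lt_div_iff₀ (ellNorm_pos (by linarith) h0)] at h1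

lemma nullSpaceRatio_of_le {q : ℝ} (hq : 1 ≤ q) {s : ℕ} {A : Matrix (Fin m) (Fin n) ℝ} {c : ℝ}
    (hc : 3 * (s : ℝ) ^ (1 - 1 / q) < c)
    (H : ∀ h : Fin n → ℝ, A *ᵥ h = 0 → h ≠ 0 → c * ellNorm q h ≤ ellNorm 1 h) :
    NullSpaceRatio q s A := by
  refine (EReal.coe_lt_coe_iff.mpr hc).trans_le ?_
  refine le_iInf fun h => le_iInf fun hh => le_iInf fun h0 => ?_
  rw [EReal.coe_le_coe_iff, le_div_iff₀ (ellNorm_pos (by linarith) h0)]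
  exact H h hh h0

/-- The null-space ratio condition implies uniform exact recovery of sparse vectors. -/
lemma NullSpaceRatio.exactRecovery {q : ℝ} (hq : 1 < q) {s : ℕ} {A : Matrix (Fin m) (Fin n) ℝ}
    (hA : NullSpaceRatio q s A) : ExactRecovery q s A := by
  intro x₀ hx₀ hs
  refine ⟨⟨hx₀, rfl⟩, fun x hx hAx hne => ?_⟩
  have hq0 : 0 < q := by linarith
  obtain ⟨h, rfl⟩ : ∃ h, x = x₀ + h := ⟨x - x₀, by abel⟩
  have h0 : h ≠ 0 := by rintro rfl; simp at hne
  have hker : A *ᵥ h = 0 := by simpa [Matrix.mulVec_add] using hAx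
  have hratio := hA.lt hq.le hker h0
  classical
  set T : Finset (Fin n) := Finset.univ.filter fun i => x₀ i ≠ 0 with hT
  have hcard : T.card ≤ s := by
    have : (Function.support x₀) = (T : Set (Fin n)) := by
      ext i; simp [hT]
    rwa [IsSparse, this, Set.ncard_coe_finset] at hs
  have hpow : (T.card : ℝ) ^ (1 - 1 / q) ≤ (s : ℝ) ^ (1 - 1 / q) := by
    have : 0 ≤ 1 - 1 / q := by
      rw [sub_nonneg, div_le_one hq0]; exact hq.le
    gcongr
  set σ := (s : ℝ) ^ (1 - 1 / q)
  have hhT : ∑ i ∈ T, |h i| ≤ σ * ellNorm q h :=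
    (sum_abs_le_card_rpow_mul_ellNorm hq.le T h).trans
      (mul_le_mul_of_nonneg_right hpow (ellNorm_nonneg _ _))
  have hx0T : ellNorm 1 x₀ ≤ σ * ellNorm q x₀ := by
    refine le_trans (le_of_eq ?_) ((sum_abs_le_card_rpow_mul_ellNorm hq.le T x₀).trans
      (mul_le_mul_of_nonneg_right hpow (ellNorm_nonneg _ _)))
    rw [ellNorm_one, hT, Finset.sum_filter_of_ne]
    intro i _ hi; simpa using hi
  -- The constant 3 splits as 2 + 1: this bound loses `2σ‖h‖_q` on the support `T`, and the triangle
  -- inequality for `‖x₀ + h‖_q` costs one more `σ‖h‖_q`.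
  have hlow : ellNorm 1 x₀ + ellNorm 1 h - 2 * ∑ i ∈ T, |h i| ≤ ellNorm 1 (x₀ + h) := by
    simp only [ellNorm_one, hT, Finset.sum_filter, Finset.mul_sum]
    rw [← Finset.sum_add_distrib, ← Finset.sum_sub_distrib]
    refine Finset.sum_le_sum fun i _ => ?_
    by_cases hi : x₀ i = 0
    · simp [hi]
    · have := abs_sub_abs_le_abs_sub (x₀ i) (-h i)
      simp only [abs_neg, sub_neg_eq_add] at this
      simp only [ne_eq, hi, not_false_eq_true, if_true, Pi.add_apply]
      linarith
  have hadd := ellNorm_add_le hq.le x₀ h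
  have hp0 := ellNorm_pos hq0 hx₀
  have hp1 := ellNorm_pos hq0 hx
  have hh := ellNorm_pos hq0 h0
  rw [div_lt_div_iff₀ hp0 hp1]
  calc ellNorm 1 x₀ * ellNorm q (x₀ + h) ≤ ellNorm 1 x₀ * (ellNorm q x₀ + ellNorm q h) :=
        mul_le_mul_of_nonneg_left hadd (ellNorm_nonneg _ _)
    _ = ellNorm 1 x₀ * ellNorm q x₀ + ellNorm 1 x₀ * ellNorm q h := by ring
    _ ≤ ellNorm 1 x₀ * ellNorm q x₀ + σ * ellNorm q x₀ * ellNorm q h := by gcongr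
    _ = (ellNorm 1 x₀ + σ * ellNorm q h) * ellNorm q x₀ := by ring
    _ < ellNorm 1 (x₀ + h) * ellNorm q x₀ := by
        refine mul_lt_mul_of_pos_right ?_ hp0
        linarith

end Recovery

/-! ### Deterministic `ℓ₁/ℓ₂` bound on the kernel. -/

section Sparsification

/-- **Greedy Maurey sparsification.** If `v̄ = ∑ p j • v j` is a convex combination, some sum of
`k` of the points `v j` has a small value of a given quadratic form. -/
lemma exists_sum_bilin_le {E ι : Type*} [AddCommGroup E] [Module ℝ E] [Fintype ι]
    (B : E →ₗ[ℝ] E →ₗ[ℝ] ℝ) (p : ι → ℝ) (hp : ∀ j, 0 ≤ p j) (hp1 : ∑ j, p j = 1) (v : ι → E)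
    (k : ℕ) (w : E) :
    ∃ J : Fin k → ι, B (w + ∑ i, v (J i)) (w + ∑ i, v (J i)) ≤
      B (w + (k : ℝ) • ∑ j, p j • v j) (w + (k : ℝ) • ∑ j, p j • v j) +
        k * (∑ j, p j * B (v j) (v j) - B (∑ j, p j • v j) (∑ j, p j • v j)) := by
  set a := ∑ j, p j • v j with ha
  induction k generalizing w with
  | zero => exact ⟨Fin.elim0, by simp⟩
  | succ k ih =>
    set w' := w + (k : ℝ) • a with hw'
    -- Averaging one random choice adds exactly the "variance" of `v` under `B`, so some `j` does no
    -- worse. Neither positivity nor symmetry of `B` is needed.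
    have havg : ∑ j, p j * B (w' + v j) (w' + v j) =
        B (w' + a) (w' + a) + (∑ j, p j * B (v j) (v j) - B a a) := by
      have e1 : B w' a = ∑ j, p j * B w' (v j) := by simp [ha]
      have e2 : B a w' = ∑ j, p j * B (v j) w' := by simp [ha, LinearMap.sum_apply]
      simp only [map_add, LinearMap.add_apply, mul_add, Finset.sum_add_distrib, ← Finset.sum_mul,
        hp1, one_mul]
      rw [e1, e2]; ring
    obtain ⟨j, hj⟩ : ∃ j, B (w' + v j) (w' + v j) ≤
        B (w' + a) (w' + a) + (∑ j, p j * B (v j) (v j) - B a a) := by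
      by_contra! hcon
      obtain ⟨j₀, hj₀⟩ : ∃ j, 0 < p j := by
        by_contra! hneg
        have : ∑ j, p j ≤ 0 := Finset.sum_nonpos fun j _ => hneg j
        linarith
      have : ∑ j, p j * (B (w' + a) (w' + a) + (∑ j, p j * B (v j) (v j) - B a a)) <
          ∑ j, p j * B (w' + v j) (w' + v j) :=
        Finset.sum_lt_sum (fun j _ => mul_le_mul_of_nonneg_left (hcon j).le (hp j))
          ⟨j₀, Finset.mem_univ _, mul_lt_mul_of_pos_left (hcon j₀) hj₀⟩
      rw [← Finset.sum_mul, hp1, one_mul, havg] at this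
      exact lt_irrefl _ this
    obtain ⟨J, hJ⟩ := ih (w + v j)
    refine ⟨Fin.cons j J, ?_⟩
    have e3 : w + v j + (k : ℝ) • a = w' + v j := by rw [hw']; abel
    have e4 : w + ((k + 1 : ℕ) : ℝ) • a = w' + a := by
      rw [hw']; push_cast; rw [add_smul, one_smul]; abel
    rw [Fin.sum_univ_succ]
    simp only [Fin.cons_zero, Fin.cons_succ]
    rw [← add_assoc, e4]
    rw [e3] at hJ
    push_cast
    linarith

variable {m n : ℕ}

/-- The sum of the signed standard basis vectors listed by `f`. -/
def signedSum {k : ℕ} (f : Fin k → Fin n × Bool) : Fin n → ℝ :=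
  ∑ i, (if (f i).2 then (1 : ℝ) else -1) • Pi.single (f i).1 1

/-- If `A` is bounded below on all sums of `k` signed basis vectors and its columns are bounded,
the vectors in its kernel have a large `ℓ₁/ℓ₂` ratio. -/
lemma ellNorm_one_lower_of_signedSum {A : Matrix (Fin m) (Fin n) ℝ} {M : ℝ} (hM : 0 < M) {k : ℕ}
    (hlow : ∀ f : Fin k → Fin n × Bool,
      M / 2 * (signedSum f ⬝ᵥ signedSum f) ≤ (A *ᵥ signedSum f) ⬝ᵥ (A *ᵥ signedSum f))
    (hcol : ∀ j : Fin n,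
      (A *ᵥ (Pi.single j 1 : Fin n → ℝ)) ⬝ᵥ (A *ᵥ (Pi.single j 1 : Fin n → ℝ)) ≤ 2 * M)
    {h : Fin n → ℝ} (hker : A *ᵥ h = 0) :
    ((k : ℝ) - 1) * ellNorm 2 h ^ 2 ≤ 3 * ellNorm 1 h ^ 2 := by
  rcases eq_or_ne h 0 with rfl | h0
  · simp [ellNorm, Real.zero_rpow]
  rcases Nat.eq_zero_or_pos k with rfl | hk
  · have := sq_nonneg (ellNorm 2 h)
    have := sq_nonneg (ellNorm 1 h)
    push_cast; linarith
  have hN := ellNorm_pos one_pos h0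
  set N := ellNorm 1 h with hNdef
  let B : (Fin n → ℝ) →ₗ[ℝ] (Fin n → ℝ) →ₗ[ℝ] ℝ :=
    LinearMap.mk₂ ℝ (fun x y => (A *ᵥ x) ⬝ᵥ (A *ᵥ y) - M / 2 * (x ⬝ᵥ y))
      (by intros; simp only [Matrix.mulVec_add, add_dotProduct]; ring)
      (by intros; simp only [Matrix.mulVec_smul, smul_dotProduct, smul_eq_mul]; ring)
      (by intros; simp only [Matrix.mulVec_add, dotProduct_add]; ring)
      (by intros; simp only [Matrix.mulVec_smul, dotProduct_smul, smul_eq_mul]; ring)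
  have hB : ∀ x y, B x y = (A *ᵥ x) ⬝ᵥ (A *ᵥ y) - M / 2 * (x ⬝ᵥ y) := fun _ _ => rfl
  let σ : Fin n → ℝ := fun j => if 0 ≤ h j then 1 else -1
  have hσ2 : ∀ j, σ j * σ j = 1 := fun j => by simp only [σ]; split_ifs <;> norm_num
  have hσ : ∀ j, |h j| * σ j = h j := fun j => by
    simp only [σ]; split_ifs with hj
    · rw [abs_of_nonneg hj, mul_one]
    · rw [abs_of_neg (not_le.mp hj)]; ring
  let v : Fin n → Fin n → ℝ := fun j => σ j • Pi.single j 1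
  let p : Fin n → ℝ := fun j => |h j| / N
  have hp : ∀ j, 0 ≤ p j := fun j => by positivity
  have hp1 : ∑ j, p j = 1 := by
    simp only [p]; rw [← Finset.sum_div, ← ellNorm_one, ← hNdef, div_self hN.ne']
  have hv : ∑ j, p j • v j = N⁻¹ • h := by
    ext i
    simp only [p, v, Finset.sum_apply, Pi.smul_apply, smul_eq_mul, Pi.single_apply]
    simp only [mul_ite, mul_one, mul_zero, Finset.sum_ite_eq, Finset.mem_univ, if_true]
    rw [div_mul_eq_mul_div, hσ, div_eq_inv_mul]
  obtain ⟨J, hJ⟩ := exists_sum_bilin_le B p hp hp1 v k 0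
  rw [hv] at hJ
  simp only [zero_add] at hJ
  have hz : ∑ i, v (J i) = signedSum fun i => (J i, decide (0 ≤ h (J i))) := by
    simp [signedSum, v, σ]
  have hpos : 0 ≤ B (∑ i, v (J i)) (∑ i, v (J i)) := by
    rw [hz, hB, sub_nonneg]; exact hlow _
  have hBv : ∀ j, B (v j) (v j) ≤ 3 / 2 * M := by
    intro j
    have e1 : B (v j) (v j) = B (Pi.single j 1) (Pi.single j 1) := by
      simp only [v, map_smul, LinearMap.smul_apply, smul_eq_mul]
      rw [← mul_assoc, hσ2, one_mul]
    rw [e1, hB]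
    have := hcol j
    simp only [single_dotProduct, Pi.single_eq_same, mul_one]
    linarith
  have hsum : ∑ j, p j * B (v j) (v j) ≤ 3 / 2 * M := by
    calc ∑ j, p j * B (v j) (v j) ≤ ∑ j, p j * (3 / 2 * M) :=
          Finset.sum_le_sum fun j _ => mul_le_mul_of_nonneg_left (hBv j) (hp j)
      _ = 3 / 2 * M := by rw [← Finset.sum_mul, hp1, one_mul]
  have hBh : B h h = -(M / 2 * ellNorm 2 h ^ 2) := by
    rw [hB, hker, ellNorm_two_sq]; simp
  simp only [map_smul, LinearMap.smul_apply, smul_eq_mul, hBh] at hJ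
  have hk' : (0 : ℝ) < k := by exact_mod_cast hk
  have h2 := hpos.trans hJ
  have h3 : (k : ℝ) * ∑ j, p j * B (v j) (v j) ≤ k * (3 / 2 * M) :=
    mul_le_mul_of_nonneg_left hsum hk'.le
  -- With `r = ‖h‖₂²/N²`, the form at `h/N` is `-(M/2) r`: it enters `k²` times through the mean and
  -- `-k` times through the variance, whence the factor `k(k - 1)`.
  have h4 : 0 ≤ (k * M / 2) * (3 - (k - 1) * (N⁻¹ * N⁻¹ * ellNorm 2 h ^ 2)) := by
    nlinarith [h2, h3]
  have h5 : 0 ≤ 3 - (k - 1) * (N⁻¹ * N⁻¹ * ellNorm 2 h ^ 2) :=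
    nonneg_of_mul_nonneg_right h4 (by positivity)
  have h6 : (k - 1) * ellNorm 2 h ^ 2 = ((k - 1) * (N⁻¹ * N⁻¹ * ellNorm 2 h ^ 2)) * N ^ 2 := by
    field_simp
  rw [h6]
  exact mul_le_mul_of_nonneg_right (by linarith) (sq_nonneg _)

end Sparsification


/-! ### Moments of squares of sub-Gaussian variables. -/

/-- The Taylor series are compared from degree two on, where `a ^ (p + 2) ≤ a ^ 2`. -/
lemma exp_mul_le_of_abs_le_one {a y : ℝ} (ha : |a| ≤ 1) (hy : 0 ≤ y) :
    Real.exp (a * y) ≤ 1 + a * y + a ^ 2 * (Real.exp y - 1 - y) := by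
  have hs : ∀ x : ℝ, HasSum (fun p : ℕ => x ^ (p + 2) / ((p + 2).factorial : ℝ))
      (Real.exp x - 1 - x) := by
    intro x
    have h := NormedSpace.expSeries_div_hasSum_exp (𝔸 := ℝ) x
    rw [← Real.exp_eq_exp_ℝ] at h
    have h2 := (hasSum_nat_add_iff' 2).mpr h
    simpa [Finset.sum_range_succ, sub_sub] using h2
  have hle := hasSum_le (fun p => ?_) (hs (a * y)) ((hs y).mul_left (a ^ 2))
  · linarith
  · have h1 : a ^ (p + 2) ≤ a ^ 2 := by
      calc a ^ (p + 2) ≤ |a ^ (p + 2)| := le_abs_self _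
        _ = |a| ^ p * a ^ 2 := by rw [abs_pow, pow_add, sq_abs]
        _ ≤ 1 * a ^ 2 := by gcongr; exact pow_le_one₀ (abs_nonneg _) ha
        _ = a ^ 2 := one_mul _
    rw [mul_pow, ← mul_div_assoc]
    gcongr

section Moments

variable {Ω : Type*} [MeasurableSpace Ω] {μ : Measure Ω}

lemma lintegral_exp_le_of_psi2Norm_lt {X : Ω → ℝ} {t : ℝ}
    (h : psi2Norm X μ < ENNReal.ofReal t) :
    ∫⁻ ω, ENNReal.ofReal (Real.exp (|X ω| ^ 2 / t ^ 2)) ∂μ ≤ 2 := by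
  simp only [psi2Norm, iInf_lt_iff] at h
  obtain ⟨r, hr, hr2, hrt⟩ := h
  have hrt' : r < t := (ENNReal.ofReal_lt_ofReal_iff_of_nonneg hr.le).mp hrt
  refine (lintegral_mono fun ω => ?_).trans hr2
  gcongr

variable {X : Ω → ℝ} {t : ℝ}

lemma integrable_exp_sq (hX : Measurable X)
    (hexp : ∫⁻ ω, ENNReal.ofReal (Real.exp (|X ω| ^ 2 / t ^ 2)) ∂μ ≤ 2) :
    Integrable (fun ω => Real.exp (X ω ^ 2 / t ^ 2)) μ := by
  refine ⟨by fun_prop, ?_⟩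
  rw [hasFiniteIntegral_iff_ofReal (ae_of_all _ fun ω => (Real.exp_pos _).le)]
  simp only [sq_abs] at hexp
  exact hexp.trans_lt ENNReal.ofNat_lt_top

lemma integral_exp_sq_le (hX : Measurable X)
    (hexp : ∫⁻ ω, ENNReal.ofReal (Real.exp (|X ω| ^ 2 / t ^ 2)) ∂μ ≤ 2) :
    ∫ ω, Real.exp (X ω ^ 2 / t ^ 2) ∂μ ≤ 2 := by
  rw [integral_eq_lintegral_of_nonneg_ae (ae_of_all _ fun ω => (Real.exp_pos _).le)
    (integrable_exp_sq hX hexp).aestronglyMeasurable]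
  simp only [sq_abs] at hexp
  exact ENNReal.toReal_le_of_le_ofReal (by norm_num) (by simpa using hexp)

lemma integrable_exp_mul_sq (hX : Measurable X) (ht : 0 < t)
    (hexp : ∫⁻ ω, ENNReal.ofReal (Real.exp (|X ω| ^ 2 / t ^ 2)) ∂μ ≤ 2)
    {c : ℝ} (hc : |c| * t ^ 2 ≤ 1) : Integrable (fun ω => Real.exp (c * X ω ^ 2)) μ := by
  refine (integrable_exp_sq hX hexp).mono' (by fun_prop) (ae_of_all _ fun ω => ?_)
  rw [Real.norm_of_nonneg (Real.exp_pos _).le, Real.exp_le_exp, div_eq_inv_mul]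
  gcongr
  rw [← one_div, le_div_iff₀ (by positivity)]
  exact (mul_le_mul_of_nonneg_right (le_abs_self c) (sq_nonneg t)).trans hc

variable [IsProbabilityMeasure μ]

/-- Taking expectations in `1 + x ≤ exp x` gives `1 + 1/t² ≤ 2`. -/
lemma one_le_of_lintegral_exp_le (hX : Measurable X) (ht : 0 < t)
    (hexp : ∫⁻ ω, ENNReal.ofReal (Real.exp (|X ω| ^ 2 / t ^ 2)) ∂μ ≤ 2)
    (hvar : ∫ ω, X ω ^ 2 ∂μ = 1) : 1 ≤ t := by
  have hint : Integrable (fun ω => X ω ^ 2) μ := by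
    by_contra h
    rw [integral_undef h] at hvar
    exact zero_ne_one hvar
  have h1 : ∫ ω, (X ω ^ 2 / t ^ 2 + 1) ∂μ ≤ ∫ ω, Real.exp (X ω ^ 2 / t ^ 2) ∂μ :=
    integral_mono ((hint.div_const _).add (integrable_const _)) (integrable_exp_sq hX hexp)
      fun ω => Real.add_one_le_exp _
  rw [integral_add (hint.div_const _) (integrable_const _), integral_div, hvar] at h1
  have h2 := h1.trans (integral_exp_sq_le hX hexp)
  simp only [integral_const, probReal_univ, smul_eq_mul, one_mul] at h2
  have h3 : 1 / t ^ 2 ≤ 1 := by linarith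
  rw [div_le_one (by positivity)] at h3
  exact (one_le_sq_iff₀ ht.le).mp h3

lemma mgf_sq_le (hX : Measurable X) (ht : 0 < t)
    (hexp : ∫⁻ ω, ENNReal.ofReal (Real.exp (|X ω| ^ 2 / t ^ 2)) ∂μ ≤ 2)
    (hvar : ∫ ω, X ω ^ 2 ∂μ = 1) {c : ℝ} (hc : |c| * t ^ 2 ≤ 1) :
    mgf (fun ω => X ω ^ 2) μ c ≤ Real.exp (c + c ^ 2 * t ^ 4) := by
  have hint : Integrable (fun ω => X ω ^ 2) μ := by
    by_contra h
    rw [integral_undef h] at hvar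
    exact zero_ne_one hvar
  have hie := integrable_exp_sq hX hexp
  -- This is `exp_mul_le_of_abs_le_one` with `a = c t²` and `y = X²/t²`; the linear term keeps the
  -- exact mean, so the error is quadratic in `c`.
  have hpt : ∀ ω, Real.exp (c * X ω ^ 2) ≤
      (1 - c ^ 2 * t ^ 4) + (c - c ^ 2 * t ^ 2) * X ω ^ 2 +
        c ^ 2 * t ^ 4 * Real.exp (X ω ^ 2 / t ^ 2) := by
    intro ω
    have hc' : |c * t ^ 2| ≤ 1 := by rwa [abs_mul, abs_of_nonneg (sq_nonneg t)]
    have h := exp_mul_le_of_abs_le_one hc' (y := X ω ^ 2 / t ^ 2) (by positivity)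
    have e : c * t ^ 2 * (X ω ^ 2 / t ^ 2) = c * X ω ^ 2 := by field_simp
    rw [e] at h
    refine h.trans (le_of_eq ?_)
    field_simp
    ring
  calc mgf (fun ω => X ω ^ 2) μ c
      ≤ ∫ ω, ((1 - c ^ 2 * t ^ 4) + (c - c ^ 2 * t ^ 2) * X ω ^ 2 +
        c ^ 2 * t ^ 4 * Real.exp (X ω ^ 2 / t ^ 2)) ∂μ :=
        integral_mono (integrable_exp_mul_sq hX ht hexp hc)
          (((integrable_const _).add (hint.const_mul _)).add (hie.const_mul _)) hpt
    _ = (1 - c ^ 2 * t ^ 4) + (c - c ^ 2 * t ^ 2) +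
        c ^ 2 * t ^ 4 * ∫ ω, Real.exp (X ω ^ 2 / t ^ 2) ∂μ := by
        have hi : Integrable (fun ω => (1 - c ^ 2 * t ^ 4) + (c - c ^ 2 * t ^ 2) * X ω ^ 2) μ :=
          (integrable_const _).add (hint.const_mul _)
        rw [integral_add hi (hie.const_mul _),
          integral_add (integrable_const _) (hint.const_mul _), integral_const_mul,
          integral_const_mul, hvar]
        simp
    _ ≤ (1 - c ^ 2 * t ^ 4) + (c - c ^ 2 * t ^ 2) + c ^ 2 * t ^ 4 * 2 := by
        gcongr
        exact integral_exp_sq_le hX hexp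
    _ ≤ (c + c ^ 2 * t ^ 4) + 1 := by nlinarith [mul_nonneg (sq_nonneg c) (sq_nonneg t)]
    _ ≤ _ := Real.add_one_le_exp _

end Moments

/-! ### Variance of the marginals of an isotropic vector. -/

section Isotropic

variable {Ω : Type*} [MeasurableSpace Ω] {μ : Measure Ω} {n : ℕ} {X : Ω → Fin n → ℝ}

lemma IsIsotropic.integral_dotProduct_sq (hX : ∀ j, Measurable fun ω => X ω j)
    (h : IsIsotropic X μ) (g : Fin n → ℝ) : ∫ ω, (g ⬝ᵥ X ω) ^ 2 ∂μ = g ⬝ᵥ g := by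
  have hL2 : ∀ j, MemLp (fun ω => X ω j) 2 μ := by
    intro j
    rw [memLp_two_iff_integrable_sq (hX j).aestronglyMeasurable]
    by_contra hn
    have hj := h j j
    simp only [← sq, Matrix.one_apply_eq] at hj
    rw [integral_undef hn] at hj
    exact zero_ne_one hj
  have hint : ∀ i j, Integrable (fun ω => X ω i * X ω j) μ := fun i j =>
    (hL2 i).integrable_mul (hL2 j)
  have e : ∀ ω, (g ⬝ᵥ X ω) ^ 2 = ∑ i, ∑ j, g i * g j * (X ω i * X ω j) := by
    intro ω
    rw [sq, dotProduct, Finset.sum_mul_sum]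
    exact Finset.sum_congr rfl fun i _ => Finset.sum_congr rfl fun j _ => by ring
  simp only [e]
  rw [integral_finsetSum _ fun i _ => integrable_finsetSum _ fun j _ => (hint i j).const_mul _]
  refine Finset.sum_congr rfl fun i _ => ?_
  rw [integral_finsetSum _ fun j _ => (hint i j).const_mul _]
  simp only [integral_const_mul, h i _, Matrix.one_apply]
  simp

end Isotropic

/-! ### Chernoff bounds for sums of squares. -/

section Concentration

variable {Ω : Type*} [MeasurableSpace Ω] {μ : Measure Ω} [IsProbabilityMeasure μ] {m : ℕ}
  {X : Fin m → Ω → ℝ} {t : ℝ}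

lemma mgf_sum_sq_le (hX : ∀ i, Measurable (X i)) (hind : iIndepFun X μ) (ht : 0 < t)
    (hexp : ∀ i, ∫⁻ ω, ENNReal.ofReal (Real.exp (|X i ω| ^ 2 / t ^ 2)) ∂μ ≤ 2)
    (hvar : ∀ i, ∫ ω, X i ω ^ 2 ∂μ = 1) {c : ℝ} (hc : |c| * t ^ 2 ≤ 1) :
    Integrable (fun ω => Real.exp (c * ∑ i, X i ω ^ 2)) μ ∧
      mgf (fun ω => ∑ i, X i ω ^ 2) μ c ≤ Real.exp (m * (c + c ^ 2 * t ^ 4)) := by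
  have hmeas : ∀ i, Measurable (fun ω => X i ω ^ 2) := fun i => (hX i).pow_const 2
  have hind2 : iIndepFun (fun i ω => X i ω ^ 2) μ :=
    hind.comp (fun _ x => x ^ 2) fun _ => measurable_id.pow_const 2
  have e : (fun ω => ∑ i, X i ω ^ 2) = ∑ i, fun ω => X i ω ^ 2 := by
    ext ω; simp
  constructor
  · have := hind2.integrable_exp_mul_sum (t := c) hmeas (s := Finset.univ)
      fun i _ => integrable_exp_mul_sq (hX i) ht (hexp i) hc
    simpa using this
  · rw [e, hind2.mgf_sum hmeas]
    calc ∏ i, mgf (fun ω => X i ω ^ 2) μ c ≤ ∏ _i : Fin m, Real.exp (c + c ^ 2 * t ^ 4) :=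
          Finset.prod_le_prod (fun i _ => mgf_nonneg)
            fun i _ => mgf_sq_le (hX i) ht (hexp i) (hvar i) hc
      _ = _ := by rw [Finset.prod_const, Finset.card_univ, Fintype.card_fin, ← Real.exp_nat_mul]

/-- Chernoff bounds for a sum of squares of independent sub-Gaussian variables of variance one. -/
lemma measureReal_sum_sq_tails (hX : ∀ i, Measurable (X i)) (hind : iIndepFun X μ) (ht : 1 ≤ t)
    (hexp : ∀ i, ∫⁻ ω, ENNReal.ofReal (Real.exp (|X i ω| ^ 2 / t ^ 2)) ∂μ ≤ 2)
    (hvar : ∀ i, ∫ ω, X i ω ^ 2 ∂μ = 1) :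
    μ.real {ω | ∑ i, X i ω ^ 2 ≤ m / 2} ≤ Real.exp (-(m / (16 * t ^ 4))) ∧
      μ.real {ω | 2 * m ≤ ∑ i, X i ω ^ 2} ≤ Real.exp (-(m / (16 * t ^ 4))) := by
  have ht0 : 0 < t := by linarith
  -- This choice makes the quadratic error `c² t⁴` equal to `c/4`; the exponents are then `-mc/4`
  -- for the lower tail and `-3mc/4` for the upper one.
  set c : ℝ := 1 / (4 * t ^ 4) with hcdef
  have hc0 : 0 < c := by positivity
  have hct : c * t ^ 4 = 1 / 4 := by rw [hcdef]; field_simp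
  have hcm : (m : ℝ) / (16 * t ^ 4) = m * c / 4 := by rw [hcdef]; field_simp; norm_num
  have hc : |c| * t ^ 2 ≤ 1 := by
    rw [abs_of_pos hc0]
    have : c * t ^ 2 ≤ c * t ^ 4 := by gcongr; norm_num
    linarith
  have hm : (0 : ℝ) ≤ m * c := by positivity
  constructor
  · obtain ⟨hi, hb⟩ := mgf_sum_sq_le hX hind ht0 hexp hvar (c := -c) (by rwa [abs_neg])
    refine (measure_le_le_exp_mul_mgf _ (by linarith) hi).trans ?_
    refine (mul_le_mul_of_nonneg_left hb (Real.exp_pos _).le).trans ?_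
    rw [← Real.exp_add, Real.exp_le_exp, hcm]
    have : (m : ℝ) * (-c + (-c) ^ 2 * t ^ 4) = m * c * (-1 + c * t ^ 4) := by ring
    rw [this, hct]
    linarith
  · obtain ⟨hi, hb⟩ := mgf_sum_sq_le hX hind ht0 hexp hvar hc
    refine (measure_ge_le_exp_mul_mgf _ hc0.le hi).trans ?_
    refine (mul_le_mul_of_nonneg_left hb (Real.exp_pos _).le).trans ?_
    rw [← Real.exp_add, Real.exp_le_exp, hcm]
    have : (m : ℝ) * (c + c ^ 2 * t ^ 4) = m * c * (1 + c * t ^ 4) := by ring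
    rw [this, hct]
    linarith

end Concentration


/-! ### Union bound for the random matrix. -/

section RandomMatrix

variable {Ω : Type*} [MeasurableSpace Ω] {μ : Measure Ω} [IsProbabilityMeasure μ] {m n : ℕ}
  {A : Ω → Matrix (Fin m) (Fin n) ℝ} {t : ℝ}

lemma measureReal_mulVec_tails (hA : ∀ i j, Measurable (fun ω => A ω i j))
    (hind : iIndepFun (fun (i : Fin m) (ω : Ω) => (A ω i : Fin n → ℝ)) μ)
    (hiso : ∀ i, IsIsotropic (fun ω => A ω i) μ) (ht : 1 ≤ t)
    (hpsi : ∀ i, vecPsi2Norm (fun ω => A ω i) μ < ENNReal.ofReal t)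
    {g : Fin n → ℝ} (hg : ellNorm 2 g = 1) :
    μ.real {ω | (A ω *ᵥ g) ⬝ᵥ (A ω *ᵥ g) ≤ m / 2} ≤ Real.exp (-(m / (16 * t ^ 4))) ∧
      μ.real {ω | 2 * m ≤ (A ω *ᵥ g) ⬝ᵥ (A ω *ᵥ g)} ≤ Real.exp (-(m / (16 * t ^ 4))) := by
  have hgm : ∀ i : Fin m, Measurable fun ω => g ⬝ᵥ A ω i := fun i =>
    Finset.measurable_sum _ fun j _ => (hA i j).const_mul _
  have hgind : iIndepFun (fun (i : Fin m) ω => g ⬝ᵥ A ω i) μ :=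
    hind.comp (fun _ x => g ⬝ᵥ x) fun _ =>
      Finset.measurable_sum _ fun j _ => (measurable_pi_apply j).const_mul _
  have hvar : ∀ i, ∫ ω, (g ⬝ᵥ A ω i) ^ 2 ∂μ = 1 := fun i => by
    rw [(hiso i).integral_dotProduct_sq (hA i), ← ellNorm_two_sq, hg, one_pow]
  have hexp : ∀ i, ∫⁻ ω, ENNReal.ofReal (Real.exp (|g ⬝ᵥ A ω i| ^ 2 / t ^ 2)) ∂μ ≤ 2 := fun i =>
    lintegral_exp_le_of_psi2Norm_lt
      ((le_iSup₂ (f := fun g (_ : ellNorm 2 g = 1) => psi2Norm (fun ω => g ⬝ᵥ A ω i) μ)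
        g hg).trans_lt (hpsi i))
  have e : ∀ ω, (A ω *ᵥ g) ⬝ᵥ (A ω *ᵥ g) = ∑ i, (g ⬝ᵥ A ω i) ^ 2 := fun ω =>
    Finset.sum_congr rfl fun i _ => by
      rw [sq]; simp only [Matrix.mulVec]; rw [dotProduct_comm g]
  simp only [e]
  exact measureReal_sum_sq_tails hgm hgind ht hexp hvar

lemma measureReal_mulVec_lt_le (hA : ∀ i j, Measurable (fun ω => A ω i j))
    (hind : iIndepFun (fun (i : Fin m) (ω : Ω) => (A ω i : Fin n → ℝ)) μ)
    (hiso : ∀ i, IsIsotropic (fun ω => A ω i) μ) (ht : 1 ≤ t)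
    (hpsi : ∀ i, vecPsi2Norm (fun ω => A ω i) μ < ENNReal.ofReal t) (z : Fin n → ℝ) :
    μ.real {ω | (A ω *ᵥ z) ⬝ᵥ (A ω *ᵥ z) < m / 2 * (z ⬝ᵥ z)} ≤
      Real.exp (-(m / (16 * t ^ 4))) := by
  -- Signed sums may cancel to zero; the strict inequality makes the event empty then.
  rcases eq_or_ne z 0 with rfl | hz
  · simp [Real.exp_nonneg]
  have hN := ellNorm_pos two_pos hz
  set N := ellNorm 2 z with hNdef
  have hzN : z ⬝ᵥ z = N ^ 2 := (ellNorm_two_sq z).symm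
  have hg : ellNorm 2 (N⁻¹ • z) = 1 := by
    rw [← sq_eq_sq₀ (ellNorm_nonneg _ _) zero_le_one, ellNorm_two_sq, smul_dotProduct,
      dotProduct_smul, hzN]
    simp only [smul_eq_mul]
    field_simp
  refine le_trans (measureReal_mono fun ω hω => ?_)
    (measureReal_mulVec_tails hA hind hiso ht hpsi hg).1
  simp only [Set.mem_ofPred_eq, hzN] at hω ⊢
  rw [Matrix.mulVec_smul, smul_dotProduct, dotProduct_smul]
  simp only [smul_eq_mul]
  rw [← mul_assoc, ← mul_inv, ← sq, inv_mul_le_iff₀ (by positivity)]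
  linarith

/-- With high probability, all kernel vectors have a large `ℓ₁/ℓ₂` ratio. -/
lemma measureReal_kernel_ratio (hA : ∀ i j, Measurable (fun ω => A ω i j))
    (hind : iIndepFun (fun (i : Fin m) (ω : Ω) => (A ω i : Fin n → ℝ)) μ)
    (hiso : ∀ i, IsIsotropic (fun ω => A ω i) μ) (ht : 1 ≤ t)
    (hpsi : ∀ i, vecPsi2Norm (fun ω => A ω i) μ < ENNReal.ofReal t) (hm : 0 < m) (k : ℕ) :
    1 - ((2 * n : ℝ) ^ k + n) * Real.exp (-(m / (16 * t ^ 4))) ≤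
      μ.real {ω | ∀ h : Fin n → ℝ, A ω *ᵥ h = 0 →
        ((k : ℝ) - 1) * ellNorm 2 h ^ 2 ≤ 3 * ellNorm 1 h ^ 2} := by
  set ε := Real.exp (-(m / (16 * t ^ 4)))
  set G := {ω | ∀ h : Fin n → ℝ, A ω *ᵥ h = 0 →
        ((k : ℝ) - 1) * ellNorm 2 h ^ 2 ≤ 3 * ellNorm 1 h ^ 2}
  let b₁ : (Fin k → Fin n × Bool) → Set Ω := fun f =>
    {ω | (A ω *ᵥ signedSum f) ⬝ᵥ (A ω *ᵥ signedSum f) < m / 2 * (signedSum f ⬝ᵥ signedSum f)}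
  let b₂ : Fin n → Set Ω := fun j =>
    {ω | 2 * m ≤ (A ω *ᵥ (Pi.single j 1 : Fin n → ℝ)) ⬝ᵥ (A ω *ᵥ (Pi.single j 1 : Fin n → ℝ))}
  -- Covering the whole space and using subadditivity avoids any measurability of `G`.
  have hcover : Set.univ ⊆ G ∪ ((⋃ f, b₁ f) ∪ ⋃ j, b₂ j) := by
    intro ω _
    by_cases h₁ : ω ∈ ⋃ f, b₁ f
    · exact Or.inr (Or.inl h₁)
    by_cases h₂ : ω ∈ ⋃ j, b₂ j
    · exact Or.inr (Or.inr h₂)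
    simp only [b₁, b₂, Set.mem_iUnion, Set.mem_ofPred_eq, not_exists, not_lt, not_le] at h₁ h₂
    exact Or.inl fun h hh =>
      ellNorm_one_lower_of_signedSum (Nat.cast_pos.mpr hm) h₁ (fun j => (h₂ j).le) hh
  have hb₁ : μ.real (⋃ f, b₁ f) ≤ (2 * n : ℝ) ^ k * ε := by
    refine (measureReal_iUnion_fintype_le _).trans ?_
    refine (Finset.sum_le_sum fun f _ =>
      measureReal_mulVec_lt_le hA hind hiso ht hpsi (signedSum f)).trans (le_of_eq ?_)
    simp [ε, mul_comm]
  have hb₂ : μ.real (⋃ j, b₂ j) ≤ n * ε := by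
    refine (measureReal_iUnion_fintype_le _).trans ?_
    refine (Finset.sum_le_sum fun j _ =>
      (measureReal_mulVec_tails hA hind hiso ht hpsi ?_).2).trans (le_of_eq ?_)
    · rw [← sq_eq_sq₀ (ellNorm_nonneg _ _) zero_le_one, ellNorm_two_sq]
      simp
    · simp [ε]
  have h1 : (1 : ℝ) ≤ μ.real G + (μ.real (⋃ f, b₁ f) + μ.real (⋃ j, b₂ j)) := by
    calc (1 : ℝ) = μ.real Set.univ := probReal_univ.symm
      _ ≤ μ.real (G ∪ ((⋃ f, b₁ f) ∪ ⋃ j, b₂ j)) := measureReal_mono hcover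
      _ ≤ μ.real G + μ.real ((⋃ f, b₁ f) ∪ ⋃ j, b₂ j) := measureReal_union_le _ _
      _ ≤ _ := by gcongr; exact measureReal_union_le _ _
  linarith

lemma one_le_of_vecPsi2Norm_le {X : Ω → Fin n → ℝ} (hn : 0 < n)
    (hX : ∀ j, Measurable fun ω => X ω j) (hiso : IsIsotropic X μ) {F : ℝ}
    (hF : vecPsi2Norm X μ ≤ ENNReal.ofReal F) : 1 ≤ F := by
  by_contra! hF1
  obtain ⟨r, hr, hr1⟩ := exists_between (max_lt hF1 zero_lt_one)
  obtain ⟨hFr, hr0⟩ := max_lt_iff.mp hr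
  let g : Fin n → ℝ := Pi.single ⟨0, hn⟩ 1
  have hg2 : g ⬝ᵥ g = 1 := by simp [g]
  have hg : ellNorm 2 g = 1 := by
    rw [← sq_eq_sq₀ (ellNorm_nonneg _ _) zero_le_one, ellNorm_two_sq, hg2, one_pow]
  have hpsi : psi2Norm (fun ω => g ⬝ᵥ X ω) μ < ENNReal.ofReal r :=
    ((le_iSup₂ (f := fun g (_ : ellNorm 2 g = 1) => psi2Norm (fun ω => g ⬝ᵥ X ω) μ)
      g hg).trans hF).trans_lt ((ENNReal.ofReal_lt_ofReal_iff hr0).mpr hFr)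
  have := one_le_of_lintegral_exp_le (X := fun ω => g ⬝ᵥ X ω)
    (Finset.measurable_sum _ fun j _ => (hX j).const_mul _) hr0
    (lintegral_exp_le_of_psi2Norm_lt hpsi) (by rw [hiso.integral_dotProduct_sq hX, hg2])
  linarith

end RandomMatrix

/-! ### Passage from `ℓ₂` to `ℓ_q`. -/

lemma nullSpaceRatio_zero {m n : ℕ} {q : ℝ} (hq : 1 < q) (A : Matrix (Fin m) (Fin n) ℝ) :
    NullSpaceRatio q 0 A := by
  have hne : 1 - 1 / q ≠ 0 := by
    have : 1 / q < 1 := by rw [div_lt_one (by linarith)]; exact hq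
    linarith
  refine nullSpaceRatio_of_le hq.le (c := 1) ?_ fun h _ _ => ?_
  · rw [Nat.cast_zero, Real.zero_rpow hne]; norm_num
  · rw [one_mul]; exact ellNorm_antitone one_pos hq.le h

lemma nullSpaceRatio_of_kernel_ratio {m n : ℕ} {q : ℝ} (hq : 2 ≤ q) {s k : ℕ} (hs : 0 < s)
    {A : Matrix (Fin m) (Fin n) ℝ} (hk : 48 * (s : ℝ) ^ (2 - 2 / q) + 1 ≤ k)
    (H : ∀ h : Fin n → ℝ, A *ᵥ h = 0 →
      ((k : ℝ) - 1) * ellNorm 2 h ^ 2 ≤ 3 * ellNorm 1 h ^ 2) :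
    NullSpaceRatio q s A := by
  have hs' : (0 : ℝ) < s := by exact_mod_cast hs
  have hσ : 0 < (s : ℝ) ^ (1 - 1 / q) := by positivity
  -- The constant 4 rather than 3 keeps the infimum strictly above the threshold, and `48 = 3 * 4 ^
  -- 2`.
  refine nullSpaceRatio_of_le (by linarith) (c := 4 * (s : ℝ) ^ (1 - 1 / q)) (by linarith)
    fun h hh _ => ?_
  have e : (s : ℝ) ^ (2 - 2 / q) = ((s : ℝ) ^ (1 - 1 / q)) ^ 2 := by
    rw [sq, ← Real.rpow_add hs']; ring_nf
  rw [e] at hk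
  set σ := (s : ℝ) ^ (1 - 1 / q)
  have h1 := H h hh
  have h2 : 48 * σ ^ 2 * ellNorm 2 h ^ 2 ≤ (k - 1) * ellNorm 2 h ^ 2 := by
    gcongr; linarith
  calc 4 * σ * ellNorm q h ≤ 4 * σ * ellNorm 2 h := by
        gcongr; exact ellNorm_antitone two_pos hq h
    _ ≤ ellNorm 1 h := by
        rw [← sq_le_sq₀ (mul_nonneg (by positivity) (ellNorm_nonneg _ _)) (ellNorm_nonneg _ _)]
        linarith

end RatioRecovery

/-! ### Choice of constants and conclusion. -/

theorem theorem4p2 :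
    ∃ D : ℝ, 0 < D ∧
      ∀ (q : ℝ) (_ : 2 ≤ q) (s : ℕ) (u : ℝ) (_ : 1 ≤ u) (m n : ℕ) (_ : 2 ≤ n) (F : ℝ)
        (Ω : Type*) [MeasurableSpace Ω] (μ : Measure Ω) [IsProbabilityMeasure μ]
        (A : Ω → Matrix (Fin m) (Fin n) ℝ)
        (_ : ∀ i j, Measurable (fun ω => A ω i j))
        (_ : iIndepFun (fun (i : Fin m) (ω : Ω) => (A ω i : Fin n → ℝ)) μ)
        (_ : ∀ i, RatioRecovery.IsIsotropic (fun ω => A ω i) μ)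
        (_ : ∀ i, RatioRecovery.IsSubGaussian (fun ω => A ω i) μ)
        (_ : ∀ i, RatioRecovery.vecPsi2Norm (fun ω => A ω i) μ ≤ ENNReal.ofReal F)
        (_ : D * F ^ 4 * u ^ 2 * (s : ℝ) ^ (2 - 2 / q) * Real.log (2 * n) < m),
        1 - 2 * Real.exp (-u ^ 2) ≤ μ.real {ω | RatioRecovery.NullSpaceRatio q s (A ω)} ∧
          ∀ ω, RatioRecovery.NullSpaceRatio q s (A ω) → RatioRecovery.ExactRecovery q s (A ω) := by
  refine ⟨2000, by norm_num, ?_⟩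
  intro q hq s u hu m n hn F Ω _ μ _ A hA hind hiso _ hpsi hm
  refine ⟨?_, fun ω hω => hω.exactRecovery (by linarith)⟩
  have hn' : (2 : ℝ) ≤ n := by exact_mod_cast hn
  have hL : 1 ≤ Real.log (2 * n) := by
    rw [Real.le_log_iff_exp_le (by linarith)]
    linarith [Real.exp_one_lt_d9]
  set L := Real.log (2 * n) with hLdef
  have hS0 : 0 ≤ (s : ℝ) ^ (2 - 2 / q) := by positivity
  have hm0 : 0 < m := by
    have : (0 : ℝ) < m := lt_of_le_of_lt (by positivity) hm
    exact_mod_cast this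
  have hF : 1 ≤ F :=
    RatioRecovery.one_le_of_vecPsi2Norm_le (by omega) (hA ⟨0, hm0⟩) (hiso ⟨0, hm0⟩) (hpsi ⟨0, hm0⟩)
  -- For `s = 0` the hypothesis yields only `m > 0`, but the threshold is 0 and every ratio is at
  -- least 1.
  rcases Nat.eq_zero_or_pos s with rfl | hs
  · simp only [RatioRecovery.nullSpaceRatio_zero (show 1 < q by linarith), Set.ofPred_true,
      probReal_univ]
    linarith [Real.exp_pos (-u ^ 2)]
  have hS : 1 ≤ (s : ℝ) ^ (2 - 2 / q) := by
    have : 2 / q ≤ 1 := by rw [div_le_one (by linarith)]; exact hq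
    exact Real.one_le_rpow (by exact_mod_cast hs) (by linarith)
  set S := (s : ℝ) ^ (2 - 2 / q) with hSdef
  obtain ⟨k, hk, hk'⟩ : ∃ k : ℕ, 48 * S + 1 ≤ k ∧ (k : ℝ) ≤ 50 * S :=
    ⟨⌈48 * S + 1⌉₊, Nat.le_ceil _, by
      have := Nat.ceil_lt_add_one (a := 48 * S + 1) (by linarith)
      linarith⟩
  -- A parameter slightly above `F` gives the strict bound on the Orlicz norms; `D = 2000` suffices
  -- since `51 * 16 * (6/5)^4 < 1693`.
  have hprob := RatioRecovery.measureReal_kernel_ratio hA hind hiso (t := 6 / 5 * F) (by linarith)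
    (fun i => (hpsi i).trans_lt
      ((ENNReal.ofReal_lt_ofReal_iff (by linarith)).mpr (by linarith))) hm0 k
  refine le_trans ?_ (hprob.trans (measureReal_mono fun ω hω =>
    RatioRecovery.nullSpaceRatio_of_kernel_ratio hq hs hk hω))
  have hexp : 50 * S * L + u ^ 2 ≤ m / (16 * (6 / 5 * F) ^ 4) := by
    have hF4 : 0 < F ^ 4 := by positivity
    rw [le_div_iff₀ (by positivity)]
    refine le_trans ?_ hm.le
    have hu2 : 1 ≤ u ^ 2 := one_le_pow₀ hu
    have hSL : 1 ≤ S * L := one_le_mul_of_one_le_of_one_le hS hL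
    have h1 : S * L ≤ u ^ 2 * (S * L) := le_mul_of_one_le_left (by linarith) hu2
    have h2 : u ^ 2 ≤ u ^ 2 * (S * L) := le_mul_of_one_le_right (by linarith) hSL
    have h3 : 50 * S * L + u ^ 2 ≤ 51 * (u ^ 2 * (S * L)) := by linarith
    have h4 : (50 * S * L + u ^ 2) * F ^ 4 ≤ 51 * (u ^ 2 * (S * L)) * F ^ 4 := by gcongr
    have h5 : 0 ≤ u ^ 2 * (S * L) * F ^ 4 := by positivity
    linarith
  have hpow : (2 * n : ℝ) ^ k ≤ Real.exp (50 * S * L) := by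
    rw [← Real.exp_log (show (0 : ℝ) < 2 * n by linarith), ← Real.exp_nat_mul, ← hLdef,
      Real.exp_le_exp]
    gcongr
  have hn1 : (n : ℝ) ≤ Real.exp (50 * S * L) := by
    calc (n : ℝ) ≤ Real.exp L := by rw [hLdef, Real.exp_log (by linarith)]; linarith
      _ ≤ _ := by
        rw [Real.exp_le_exp]
        exact le_mul_of_one_le_left (by linarith) (by linarith)
  have hfin : ((2 * n : ℝ) ^ k + n) * Real.exp (-(m / (16 * (6 / 5 * F) ^ 4))) ≤
      2 * Real.exp (-u ^ 2) := by
    calc _ ≤ (Real.exp (50 * S * L) + Real.exp (50 * S * L)) *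
          Real.exp (-(50 * S * L + u ^ 2)) := by gcongr
      _ = 2 * Real.exp (-u ^ 2) := by
        rw [← two_mul, mul_assoc, ← Real.exp_add]; congr 2; ring
  linarith
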